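/- Theorem (contraction inequality). Let $N\ge 2$, $q>2$ and $1\le s<\infty$. Let $f\in L^s(\mathbb R^N)$ with $f\ge 0$ a.e., and let $v\in L^1_{loc}(\mathbb R^N)$ be nonnegative a.e. and satisfy $$-\Delta v+v^{q-1}\le f\quad\text{in }\mathscr D'(\mathbb R^N),$$ i.e. $v^{q-1}\in L^1_{loc}(\mathbb R^N)$ and $$-\int_{\mathbb R^N} v\,\Delta\varphi\,dx+\int_{\mathbb R^N} v^{q-1}\varphi\,dx\le\int_{\mathbb R^N} f\varphi\,dx\qquad\text{for all } 0\le\varphi\in C_c^\infty(\mathbb R^N).$$ Then $v^{q-1}\in L^s(\mathbb R^N)$ and $$\|v\|_{(q-1)s}^{\,q-1}\le\|f\|_s .$$ -/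

import Mathlib

open MeasureTheory
open scoped ContDiff ENNReal

/-- `IsDistribSubsolution q f v`: the inequality `-Δ v + v ^ (q - 1) ≤ f` holds in the sense of
distributions on `ℝᴺ`. The terms `v`, `v ^ (q - 1)` and `f` are locally integrable, so that each of
them is a distribution, and the inequality holds when tested against every nonnegative
`φ ∈ C_c^∞(ℝᴺ)`. It is meant for (almost everywhere) nonnegative `v`. -/
structure IsDistribSubsolution {N : ℕ} (q : ℝ) (f v : EuclideanSpace ℝ (Fin N) → ℝ) : Prop where
  locallyIntegrable : LocallyIntegrable v volume
  locallyIntegrable_rpow : LocallyIntegrable (fun x => v x ^ (q - 1)) volume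
  locallyIntegrable_rhs : LocallyIntegrable f volume
  le_of_test : ∀ φ : EuclideanSpace ℝ (Fin N) → ℝ,
    ContDiff ℝ ∞ φ → HasCompactSupport φ → (∀ x, 0 ≤ φ x) →
      -(∫ x, v x * Laplacian.laplacian φ x) + ∫ x, v x ^ (q - 1) * φ x ≤ ∫ x, f x * φ x

/-! Put `p = q - 1 > 1`. Mollifying the inequality and applying Jensen to `t ↦ t ^ p` gives smooth
`u, g ≥ 0` with `u ^ p ≤ g + Δ u` pointwise (`IsDistribSubsolution.mollify_rpow_le`).

Multiply by `β(u) ≈ u ^ (p (s - 1))`. If `H' = β`, then `H` is convex, so `β(u) Δ u ≤ Δ (H ∘ u)`;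
Young's inequality turns `s β(u) g` into `g ^ s` plus a term absorbed on the left. Up to truncation,
`u ^ (p s) ≤ g ^ s + s Δ (H ∘ u)`. Against a cutoff `φ = ψ ^ (2 n + 2)` of radius `R`, the last term
becomes `s ∫ H(u) Δ φ`.

Nothing is known about `u` at infinity, so this error is beaten by superlinearity, as in
Keller-Osserman: since `p > 1`, `H(u) Δ φ` is at most a small multiple of `u ^ (p s) φ` plus a
constant of order `R ^ (-2 n - 2)` (`absorb_cutoff_error`), whose integral over a ball of radius `2
R` vanishes as `R → ∞` once `n` is large. Fatou's lemma removes first the truncation and cutoff,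
then the mollification. -/

/-! ### Calculus of the Laplacian -/

section LaplacianCalculus

open Laplacian Convolution

theorem ContDiff.fderiv_apply_const {E : Type*} [NormedAddCommGroup E]
    [NormedSpace ℝ E] {u : E → ℝ} {n m : WithTop ℕ∞} (hu : ContDiff ℝ n u)
    (hm : m + 1 ≤ n) (e : E) : ContDiff ℝ m fun y => fderiv ℝ u y e :=
  (hu.fderiv_right hm).clm_apply contDiff_const

theorem HasCompactSupport.fderiv_apply_const {E : Type*} [NormedAddCommGroup E]
    [NormedSpace ℝ E] {u : E → ℝ} (hu : HasCompactSupport u) (e : E) :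
    HasCompactSupport fun y => fderiv ℝ u y e :=
  hu.fderiv_apply (𝕜 := ℝ) e

variable {E : Type*} [NormedAddCommGroup E] [InnerProductSpace ℝ E] [FiniteDimensional ℝ E]

theorem laplacian_eq_sum_fderiv_fderiv {u : E → ℝ} (hu : ContDiff ℝ 2 u) (x : E) :
    Δ u x = ∑ i, fderiv ℝ (fun y => fderiv ℝ u y (stdOrthonormalBasis ℝ E i)) x
      (stdOrthonormalBasis ℝ E i) := by
  rw [InnerProductSpace.laplacian_eq_iteratedFDeriv_stdOrthonormalBasis]
  refine Finset.sum_congr rfl fun i _ => ?_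
  have h : DifferentiableAt ℝ (fderiv ℝ u) x :=
    ((hu.fderiv_right (m := 1) (by norm_num)).differentiable one_ne_zero) x
  rw [iteratedFDeriv_two_apply, fderiv_clm_apply h (differentiableAt_const _)]
  simp

theorem ContDiff.continuous_laplacian {u : E → ℝ} (hu : ContDiff ℝ 2 u) : Continuous (Δ u) := by
  rw [funext (laplacian_eq_sum_fderiv_fderiv hu)]
  exact continuous_finsetSum _ fun i _ =>
    ((hu.fderiv_apply_const (m := 1) (by norm_num) _).fderiv_apply_const
      (m := 0) (by norm_num) _).continuous

theorem HasCompactSupport.laplacian {u : E → ℝ} (hu : HasCompactSupport u) :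
    HasCompactSupport (Δ u) := by
  refine HasCompactSupport.intro hu fun x hx => ?_
  have h : u =ᶠ[nhds x] fun _ => 0 := notMem_tsupport_iff_eventuallyEq.1 hx
  have := (InnerProductSpace.laplacian_congr_nhds h).eq_of_nhds
  rw [this, InnerProductSpace.laplacian_const]
  rfl

/-- Used with `r = R⁻¹` to rescale the cutoff and with `r = -1` to reflect the mollifier. -/
theorem laplacian_comp_affine {u : E → ℝ} (hu : ContDiff ℝ 2 u) (c : E) (r : ℝ) (x : E) :
    Δ (fun y => u (c + r • y)) x = r ^ 2 * Δ u (c + r • x) := by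
  have hA : ∀ x : E, HasFDerivAt (fun y : E => c + r • y) (r • ContinuousLinearMap.id ℝ E) x :=
    fun x => ((hasFDerivAt_id x).const_smul r).const_add c
  have key : ∀ w : E → ℝ, Differentiable ℝ w → ∀ e y,
      fderiv ℝ (fun y => w (c + r • y)) y e = r * fderiv ℝ w (c + r • y) e := by
    intro w hw e y
    have := ((hw (c + r • y)).hasFDerivAt.comp y (hA y)).fderiv
    simp only [Function.comp_def] at this
    rw [this]
    simp
  have hA' : ContDiff ℝ 2 (fun y : E => c + r • y) := by fun_prop
  rw [laplacian_eq_sum_fderiv_fderiv hu, laplacian_eq_sum_fderiv_fderiv (u := fun y => u (c + r • y)) (hu.comp hA'),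
    Finset.mul_sum]
  refine Finset.sum_congr rfl fun i _ => ?_
  have hd := (hu.fderiv_apply_const (m := 1) (by norm_num)
    (stdOrthonormalBasis ℝ E i)).differentiable one_ne_zero
  simp only [key u (hu.differentiable two_ne_zero)]
  rw [fderiv_const_mul]
  · simp only [smul_apply, smul_eq_mul]
    rw [key _ hd]
    ring
  · exact (hd _).comp x (hA x).differentiableAt

theorem laplacian_comp {H : ℝ → ℝ} {u : E → ℝ} (hH : ContDiff ℝ 2 H) (hu : ContDiff ℝ 2 u)
    (x : E) :
    Δ (fun y => H (u y)) x = deriv H (u x) * Δ u x +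
      deriv (deriv H) (u x) * ∑ i, fderiv ℝ u x (stdOrthonormalBasis ℝ E i) ^ 2 := by
  have hdH : Differentiable ℝ (deriv H) :=
    ((contDiff_succ_iff_deriv (n := 1)).1 (by simpa [one_add_one_eq_two] using hH)).2.2.differentiable
      one_ne_zero
  have key : ∀ w : ℝ → ℝ, Differentiable ℝ w → ∀ e y,
      fderiv ℝ (fun y => w (u y)) y e = deriv w (u y) * fderiv ℝ u y e := by
    intro w hw e y
    have := ((hw (u y)).hasDerivAt.comp_hasFDerivAt y
      (hu.differentiable two_ne_zero y).hasFDerivAt).fderiv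
    simp only [Function.comp_def] at this
    rw [this]
    simp
  rw [laplacian_eq_sum_fderiv_fderiv hu, laplacian_eq_sum_fderiv_fderiv (u := fun y => H (u y)) (hH.comp hu),
    Finset.mul_sum, Finset.mul_sum, ← Finset.sum_add_distrib]
  refine Finset.sum_congr rfl fun i _ => ?_
  have hd := (hu.fderiv_apply_const (m := 1) (by norm_num)
    (stdOrthonormalBasis ℝ E i)).differentiable one_ne_zero
  simp only [key H (hH.differentiable two_ne_zero)]
  rw [fderiv_fun_mul (c := fun y => deriv H (u y))
    ((hdH _).comp x (hu.differentiable two_ne_zero x)) (hd x)]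
  simp only [add_apply, smul_apply, smul_eq_mul]
  rw [key _ hdH]
  ring

variable [MeasurableSpace E] [BorelSpace E]

/-- Two integrations by parts; compact support of `φ` alone removes the boundary terms. -/
theorem integral_mul_laplacian_comm {u φ : E → ℝ} (hu : ContDiff ℝ 2 u) (hφ : ContDiff ℝ 2 φ)
    (hc : HasCompactSupport φ) : ∫ x, u x * Δ φ x = ∫ x, Δ u x * φ x := by
  have h2 : (2 : WithTop ℕ∞) = 1 + 1 := by norm_num
  have c1 : ∀ {w : E → ℝ}, ContDiff ℝ 2 w → ∀ e, ContDiff ℝ 1 fun y => fderiv ℝ w y e :=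
    fun hw e => hw.fderiv_apply_const h2.ge e
  have c0 : ∀ {w : E → ℝ}, ContDiff ℝ 2 w → ∀ e, Continuous
      fun x => fderiv ℝ (fun y => fderiv ℝ w y e) x e :=
    fun hw e => ((c1 hw e).fderiv_apply_const (m := 0) (by norm_num) e).continuous
  simp only [laplacian_eq_sum_fderiv_fderiv hu, laplacian_eq_sum_fderiv_fderiv hφ,
    Finset.mul_sum, Finset.sum_mul]
  have I1 : ∀ e, Integrable fun x => u x * fderiv ℝ (fun y => fderiv ℝ φ y e) x e := fun e =>
    (hu.continuous.mul (c0 hφ e)).integrable_of_hasCompactSupport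
      ((hc.fderiv_apply_const e).fderiv_apply_const e).mul_left
  have I2 : ∀ e, Integrable fun x => fderiv ℝ u x e * fderiv ℝ φ x e := fun e =>
    ((c1 hu e).continuous.mul (c1 hφ e).continuous).integrable_of_hasCompactSupport
      (hc.fderiv_apply_const e).mul_left
  have I3 : ∀ e, Integrable fun x => u x * fderiv ℝ φ x e := fun e =>
    (hu.continuous.mul (c1 hφ e).continuous).integrable_of_hasCompactSupport
      (hc.fderiv_apply_const e).mul_left
  have I4 : ∀ e, Integrable fun x => fderiv ℝ (fun y => fderiv ℝ u y e) x e * φ x := fun e =>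
    ((c0 hu e).mul hφ.continuous).integrable_of_hasCompactSupport hc.mul_left
  have I5 : ∀ e, Integrable fun x => fderiv ℝ u x e * φ x := fun e =>
    ((c1 hu e).continuous.mul hφ.continuous).integrable_of_hasCompactSupport hc.mul_left
  rw [integral_finsetSum _ fun i _ => I1 _, integral_finsetSum _ fun i _ => I4 _]
  refine Finset.sum_congr rfl fun i _ => ?_
  set e := stdOrthonormalBasis ℝ E i
  rw [integral_mul_fderiv_eq_neg_fderiv_mul_of_integrable (I2 e) (I1 e) (I3 e)
      (fun x _ => hu.differentiable two_ne_zero x)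
      (fun x _ => (c1 hφ e).differentiable one_ne_zero x),
    integral_mul_fderiv_eq_neg_fderiv_mul_of_integrable (I4 e) (I2 e) (I5 e)
      (fun x _ => (c1 hu e).differentiable one_ne_zero x)
      (fun x _ => hφ.differentiable two_ne_zero x), neg_neg]

/-- Both derivatives fall on `g`, since `v` is only locally integrable. -/
theorem laplacian_convolution {g v : E → ℝ} (hg : ContDiff ℝ 2 g) (hc : HasCompactSupport g)
    (hv : LocallyIntegrable v volume) (x : E) :
    Δ (g ⋆[ContinuousLinearMap.lsmul ℝ ℝ, volume] v) x = ∫ y, Δ g (x - y) * v y := by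
  have h2 : (2 : WithTop ℕ∞) = 1 + 1 := by norm_num
  have key : ∀ w : E → ℝ, ContDiff ℝ 1 w → HasCompactSupport w → ∀ y e,
      fderiv ℝ (w ⋆[ContinuousLinearMap.lsmul ℝ ℝ, volume] v) y e =
        ((fun z => fderiv ℝ w z e) ⋆[ContinuousLinearMap.lsmul ℝ ℝ, volume] v) y := by
    intro w hw hcw y e
    rw [(hcw.hasFDerivAt_convolution_left (ContinuousLinearMap.lsmul ℝ ℝ) hw hv y).fderiv]
    have hex : ConvolutionExistsAt (fderiv ℝ w) v y
        ((ContinuousLinearMap.lsmul ℝ ℝ).precompL E) volume :=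
      (hcw.fderiv ℝ).convolutionExists_left _ (hw.continuous_fderiv one_ne_zero) hv y
    rw [convolution, ContinuousLinearMap.integral_apply hex]
    rfl
  have hcd : ContDiff ℝ 2 (g ⋆[ContinuousLinearMap.lsmul ℝ ℝ, volume] v) :=
    hc.contDiff_convolution_left (n := 2) _ hg hv
  have c1 : ∀ e, ContDiff ℝ 1 fun y => fderiv ℝ g y e :=
    fun e => hg.fderiv_apply_const h2.ge e
  rw [laplacian_eq_sum_fderiv_fderiv hcd]
  simp only [laplacian_eq_sum_fderiv_fderiv hg, Finset.sum_mul]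
  rw [integral_finsetSum]
  · refine Finset.sum_congr rfl fun i _ => ?_
    rw [funext fun y => key g (hg.of_le (by norm_num)) hc y (stdOrthonormalBasis ℝ E i),
      key _ (c1 _) (hc.fderiv_apply_const _), convolution_eq_swap]
    rfl
  · intro i _
    have := (((hc.fderiv_apply_const (stdOrthonormalBasis ℝ E i)).fderiv_apply_const
      (stdOrthonormalBasis ℝ E i)).convolutionExists_left (ContinuousLinearMap.lsmul ℝ ℝ)
      ((c1 _).fderiv_apply_const (m := 0) (by norm_num) _).continuous hv x).integrable_swap
    exact this

end LaplacianCalculus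

/-! ### Truncated powers and their primitives -/

section Truncation

/-- A smooth, monotone approximation of `t ↦ t₊ ^ a` that vanishes for `t ≤ k`. -/
noncomputable def truncRpow (k a t : ℝ) : ℝ := Real.smoothTransition (t / k - 1) * t ^ a

variable {k a t : ℝ}

theorem smoothTransition_div_sub_one_eq_zero (hk : 0 < k) (ht : t ≤ k) :
    Real.smoothTransition (t / k - 1) = 0 :=
  Real.smoothTransition.zero_of_nonpos (by rw [sub_nonpos, div_le_one hk]; exact ht)

theorem truncRpow_eq_zero (hk : 0 < k) (ht : t ≤ k) : truncRpow k a t = 0 := by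
  rw [truncRpow, smoothTransition_div_sub_one_eq_zero hk ht, zero_mul]

theorem truncRpow_nonneg (hk : 0 < k) : 0 ≤ truncRpow k a t := by
  rcases le_total t k with h | h
  · rw [truncRpow_eq_zero hk h]
  · exact mul_nonneg (Real.smoothTransition.nonneg _) (Real.rpow_nonneg (hk.le.trans h) _)

theorem truncRpow_monotone (hk : 0 < k) (ha : 0 ≤ a) : Monotone (truncRpow k a) := by
  intro x y hxy
  rcases le_total x k with h | h
  · rw [truncRpow_eq_zero hk h]
    exact truncRpow_nonneg hk
  · have hx : 0 ≤ x := hk.le.trans h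
    exact mul_le_mul (Real.smoothTransition.monotone (by gcongr))
      (Real.rpow_le_rpow hx hxy ha) (Real.rpow_nonneg hx _) (Real.smoothTransition.nonneg _)

theorem contDiff_truncRpow (hk : 0 < k) {n : ℕ∞} : ContDiff ℝ n (truncRpow k a) := by
  rw [contDiff_iff_contDiffAt]
  intro x
  rcases lt_or_ge x k with h | h
  · have : truncRpow k a =ᶠ[nhds x] fun _ => 0 := by
      filter_upwards [Iio_mem_nhds h] with y hy
      exact truncRpow_eq_zero hk (le_of_lt hy)
    exact contDiffAt_const.congr_of_eventuallyEq this
  · refine ContDiffAt.mul ?_ (Real.contDiffAt_rpow_const_of_ne (hk.trans_le h).ne')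
    exact (Real.smoothTransition.contDiff.comp
      ((contDiff_id.div_const k).sub contDiff_const)).contDiffAt

/-- The primitive of `truncRpow k a` that vanishes at `0`. -/
noncomputable def truncRpowPrimitive (k a t : ℝ) : ℝ := ∫ x in (0 : ℝ)..t, truncRpow k a x

theorem hasDerivAt_truncRpowPrimitive (hk : 0 < k) :
    HasDerivAt (truncRpowPrimitive k a) (truncRpow k a t) t :=
  have hc : Continuous (truncRpow k a) := (contDiff_truncRpow hk (n := 0)).continuous
  intervalIntegral.integral_hasDerivAt_right (hc.intervalIntegrable _ _)
    (hc.stronglyMeasurableAtFilter _ _) hc.continuousAt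

theorem deriv_truncRpowPrimitive (hk : 0 < k) :
    deriv (truncRpowPrimitive k a) = truncRpow k a :=
  funext fun _ => (hasDerivAt_truncRpowPrimitive hk).deriv

theorem contDiff_truncRpowPrimitive (hk : 0 < k) : ContDiff ℝ 2 (truncRpowPrimitive k a) := by
  have h : ContDiff ℝ (1 + 1) (truncRpowPrimitive k a) := by
    rw [contDiff_succ_iff_deriv, deriv_truncRpowPrimitive hk]
    exact ⟨fun t => (hasDerivAt_truncRpowPrimitive hk).differentiableAt, by simp,
      contDiff_truncRpow hk (n := 1)⟩
  simpa [one_add_one_eq_two] using h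

theorem truncRpowPrimitive_nonneg (hk : 0 < k) (ht : 0 ≤ t) : 0 ≤ truncRpowPrimitive k a t :=
  intervalIntegral.integral_nonneg ht fun _ _ => truncRpow_nonneg hk

/-- The integrand is monotone, hence at most its value at the right endpoint. -/
theorem truncRpowPrimitive_le (hk : 0 < k) (ha : 0 ≤ a) (ht : 0 ≤ t) :
    truncRpowPrimitive k a t ≤ truncRpow k a t * t := by
  have hc : Continuous (truncRpow k a) := (contDiff_truncRpow hk (n := 0)).continuous
  calc truncRpowPrimitive k a t ≤ ∫ _ in (0 : ℝ)..t, truncRpow k a t :=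
        intervalIntegral.integral_mono_on ht (hc.intervalIntegrable _ _)
          (continuous_const.intervalIntegrable _ _)
          fun x hx => truncRpow_monotone hk ha hx.2
    _ = truncRpow k a t * t := by simp [mul_comm]

end Truncation

/-! ### Cutoff functions -/

section Cutoff

open Laplacian

variable {E : Type*} [NormedAddCommGroup E] [InnerProductSpace ℝ E] [FiniteDimensional ℝ E]

/-- Two derivatives cost at most two powers of `ψ`. An upper bound is enough because `Δ φ` will be
multiplied by `H(u) ≥ 0`. -/
theorem laplacian_pow_le {ψ : E → ℝ} (hψ : ContDiff ℝ 2 ψ) (hc : HasCompactSupport ψ)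
    (h0 : ∀ x, 0 ≤ ψ x) (h1 : ∀ x, ψ x ≤ 1) (n : ℕ) :
    ∃ C, 0 ≤ C ∧ ∀ x, Δ (fun y => ψ y ^ (2 * n + 2)) x ≤ C * ψ x ^ (2 * n) := by
  let e := stdOrthonormalBasis ℝ E
  let S : E → ℝ := fun x => ∑ i, fderiv ℝ ψ x (e i) ^ 2
  have hS : Continuous S := continuous_finsetSum _ fun i _ =>
    (hψ.fderiv_apply_const (m := 0) (by norm_num) (e i)).continuous.pow 2
  have hSc : HasCompactSupport S := by
    refine HasCompactSupport.intro (hc.fderiv ℝ) fun x hx => ?_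
    simp [S, image_eq_zero_of_notMem_tsupport hx]
  obtain ⟨A, hA⟩ := hc.laplacian.exists_bound_of_continuous hψ.continuous_laplacian
  obtain ⟨B, hB⟩ := hSc.exists_bound_of_continuous hS
  have hA0 : 0 ≤ A := (norm_nonneg _).trans (hA 0)
  have hB0 : 0 ≤ B := (norm_nonneg _).trans (hB 0)
  refine ⟨(2 * n + 2) * A + (2 * n + 2) * (2 * n + 1) * B, by positivity, fun x => ?_⟩
  have hd : deriv (fun t : ℝ => t ^ (2 * n + 2)) = fun t => (2 * n + 2 : ℝ) * t ^ (2 * n + 1) := by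
    funext t; simp
  have hdd : deriv (fun t : ℝ => (2 * n + 2 : ℝ) * t ^ (2 * n + 1)) =
      fun t => (2 * n + 2 : ℝ) * ((2 * n + 1) * t ^ (2 * n)) := by
    funext t
    rw [deriv_const_mul _ (by fun_prop)]
    simp
  rw [laplacian_comp (H := fun t => t ^ (2 * n + 2)) (by fun_prop) hψ, hd, hdd]
  have hp : 0 ≤ ψ x ^ (2 * n) := pow_nonneg (h0 x) _
  have e1 : ψ x * Δ ψ x ≤ A := by
    calc ψ x * Δ ψ x ≤ ψ x * A :=
          mul_le_mul_of_nonneg_left ((Real.le_norm_self _).trans (hA x)) (h0 x)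
      _ ≤ A := mul_le_of_le_one_left hA0 (h1 x)
  have e2 : S x ≤ B := (Real.le_norm_self _).trans (hB x)
  calc (2 * n + 2 : ℝ) * ψ x ^ (2 * n + 1) * Δ ψ x +
        (2 * n + 2 : ℝ) * ((2 * n + 1) * ψ x ^ (2 * n)) * S x
      = ((2 * n + 2) * (ψ x * Δ ψ x) + (2 * n + 2) * (2 * n + 1) * S x) * ψ x ^ (2 * n) := by ring
    _ ≤ _ := by gcongr

/-- All the cutoffs are dilations of one bump, so `C` does not depend on `R`. -/
theorem exists_cutoff (n : ℕ) : ∃ C, 0 ≤ C ∧ ∀ R : ℝ, 0 < R → ∃ ψ : E → ℝ,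
    ContDiff ℝ ∞ ψ ∧ (∀ x, 0 ≤ ψ x) ∧ (∀ x, ψ x ≤ 1) ∧
    (∀ x ∈ Metric.closedBall 0 R, ψ x = 1) ∧ (∀ x ∉ Metric.closedBall 0 (2 * R), ψ x = 0) ∧
    ∀ x, Δ (fun y => ψ y ^ (2 * n + 2)) x ≤ C / R ^ 2 * ψ x ^ (2 * n) := by
  let b : ContDiffBump (0 : E) := ⟨1, 2, one_pos, one_lt_two⟩
  have hb : ContDiff ℝ 2 b := b.contDiff (n := 2)
  obtain ⟨C, hC, h⟩ := laplacian_pow_le hb b.hasCompactSupport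
    (fun x => b.nonneg) (fun x => b.le_one) n
  refine ⟨C, hC, fun R hR => ⟨fun x => b (0 + R⁻¹ • x), ?_, fun x => b.nonneg,
    fun x => b.le_one, fun x hx => ?_, fun x hx => ?_, fun x => ?_⟩⟩
  · exact (b.contDiff (n := (⊤ : ℕ∞))).comp (contDiff_const.add (contDiff_const_smul _))
  · refine b.one_of_mem_closedBall ?_
    simp only [Metric.mem_closedBall, dist_zero_right, zero_add, norm_smul, norm_inv,
      Real.norm_eq_abs, abs_of_pos hR, b] at hx ⊢
    rw [inv_mul_le_iff₀ hR]
    linarith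
  · refine b.zero_of_le_dist ?_
    simp only [Metric.mem_closedBall, dist_zero_right, zero_add, norm_smul, norm_inv,
      Real.norm_eq_abs, abs_of_pos hR, b, not_le] at hx ⊢
    rw [le_inv_mul_iff₀ hR]
    linarith
  · rw [laplacian_comp_affine (u := fun y => b y ^ (2 * n + 2)) (hb.pow _)]
    calc R⁻¹ ^ 2 * Δ (fun y => b y ^ (2 * n + 2)) (0 + R⁻¹ • x)
        ≤ R⁻¹ ^ 2 * (C * b (0 + R⁻¹ • x) ^ (2 * n)) := by gcongr; exact h _
      _ = _ := by rw [inv_pow]; ring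

end Cutoff

/-! ### Pointwise inequalities -/

section Pointwise

/-- Weighted AM-GM with weights `1 / s` and `1 - 1 / s`, a form that includes `s = 1`. -/
theorem mul_rpow_le_young {g t p s : ℝ} (hg : 0 ≤ g) (ht : 0 ≤ t) (hs : 1 ≤ s) :
    s * (t ^ (p * (s - 1)) * g) ≤ g ^ s + (s - 1) * t ^ (p * s) := by
  have hs0 : 0 < s := by linarith
  have h := Real.geom_mean_le_arith_mean2_weighted (w₁ := 1 / s) (w₂ := 1 - 1 / s)
    (p₁ := g ^ s) (p₂ := t ^ (p * s)) (by positivity)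
    (by rw [sub_nonneg, div_le_one hs0]; exact hs) (by positivity) (by positivity) (by ring)
  rw [← Real.rpow_mul hg, ← Real.rpow_mul ht, mul_one_div_cancel hs0.ne', Real.rpow_one,
    show p * s * (1 - 1 / s) = p * (s - 1) by field_simp] at h
  calc s * (t ^ (p * (s - 1)) * g) = s * (g * t ^ (p * (s - 1))) := by ring
    _ ≤ s * (1 / s * g ^ s + (1 - 1 / s) * t ^ (p * s)) := by gcongr
    _ = _ := by field_simp

/-- Absorption of the cutoff error: either the error is dominated by the main term, or the cutoff
is small there. -/
theorem absorb_cutoff_error {D ε k t a b ψ : ℝ} {n : ℕ} (hD : 0 ≤ D) (hε : 0 < ε) (hk : 0 < k)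
    (ht : k ≤ t) (hψ : 0 ≤ ψ) (hn : a + 1 ≤ b * n) :
    D * t ^ (a + 1) * ψ ^ (2 * n) ≤
      ε * t ^ (a + 1 + b) * ψ ^ (2 * n + 2) + D * (D / ε) ^ n * k ^ (a + 1 - b * n) := by
  have ht0 : 0 < t := hk.trans_le ht
  have hta := Real.rpow_pos_of_pos ht0 (a + 1)
  have htb := Real.rpow_pos_of_pos ht0 b
  have hkk := Real.rpow_pos_of_pos hk (a + 1 - b * n)
  rcases le_total D (ε * t ^ b * ψ ^ 2) with h | h
  · calc D * t ^ (a + 1) * ψ ^ (2 * n)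
        ≤ ε * t ^ b * ψ ^ 2 * t ^ (a + 1) * ψ ^ (2 * n) := by gcongr
      _ = ε * t ^ (a + 1 + b) * ψ ^ (2 * n + 2) := by rw [Real.rpow_add ht0 (a + 1)]; ring
      _ ≤ _ := le_add_of_nonneg_right (by positivity)
  · have h1 : ψ ^ 2 ≤ D / ε * t ^ (-b) := by
      rw [Real.rpow_neg ht0.le, ← div_eq_mul_inv, div_div, le_div_iff₀ (by positivity)]
      linarith
    calc D * t ^ (a + 1) * ψ ^ (2 * n) = D * t ^ (a + 1) * (ψ ^ 2) ^ n := by rw [pow_mul]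
      _ ≤ D * t ^ (a + 1) * (D / ε * t ^ (-b)) ^ n := by gcongr
      _ = D * (D / ε) ^ n * t ^ (a + 1 - b * n) := by
          rw [mul_pow, ← Real.rpow_natCast (t ^ (-b)), ← Real.rpow_mul ht0.le, sub_eq_add_neg,
            Real.rpow_add ht0 (a + 1), neg_mul]
          ring
      -- The exponent is nonpositive by `hn`, so the power is largest at `t = k`.
      _ ≤ D * (D / ε) ^ n * k ^ (a + 1 - b * n) := by
          have := Real.rpow_le_rpow_of_nonpos hk ht (sub_nonpos.2 hn)
          gcongr
      _ ≤ _ := le_add_of_nonneg_left (by positivity)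

end Pointwise

/-! ### The estimate for smooth subsolutions -/

section SmoothCase

open Laplacian

variable {E : Type*} [NormedAddCommGroup E] [InnerProductSpace ℝ E] [FiniteDimensional ℝ E]

/-- The inequality `-Δ u + u ^ p ≤ g`, multiplied by a truncated power of `u` and a cutoff. -/
theorem subsolution_pointwise_estimate {u g ψ : E → ℝ} {p s k ε C D : ℝ} {n : ℕ}
    (hu : ContDiff ℝ 2 u) (hu0 : ∀ x, 0 ≤ u x) (hg0 : ∀ x, 0 ≤ g x) (hp : 0 ≤ p)
    (hs : 1 ≤ s) (hk : 0 < k) (hε : 0 < ε) (hC : 0 ≤ C)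
    (hn : p * (s - 1) + 1 ≤ (p - 1) * n) (hψ0 : ∀ x, 0 ≤ ψ x)
    (hΔ : ∀ x, Δ (fun y => ψ y ^ (2 * n + 2)) x ≤ C * ψ x ^ (2 * n))
    (hsub : ∀ x, u x ^ p ≤ g x + Δ u x)
    (hD : D = s * C * (s * C / ε) ^ n * k ^ (p * (s - 1) + 1 - (p - 1) * n))
    (x : E) :
    (1 - ε) * (Real.smoothTransition (u x / k - 1) * u x ^ (p * s)) * ψ x ^ (2 * n + 2) ≤
      g x ^ s * ψ x ^ (2 * n + 2) + D +
        s * (Δ (fun y => truncRpowPrimitive k (p * (s - 1)) (u y)) x * ψ x ^ (2 * n + 2) -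
          truncRpowPrimitive k (p * (s - 1)) (u x) * Δ (fun y => ψ y ^ (2 * n + 2)) x) := by
  set a := p * (s - 1) with ha
  have ha0 : 0 ≤ a := mul_nonneg hp (by linarith)
  have hs0 : 0 < s := by linarith
  have hps : p * s = a + p := by rw [ha]; ring
  have hφ0 : 0 ≤ ψ x ^ (2 * n + 2) := pow_nonneg (hψ0 x) _
  have hβ0 : 0 ≤ truncRpow k a (u x) := truncRpow_nonneg hk
  have hH0 : 0 ≤ truncRpowPrimitive k a (u x) := truncRpowPrimitive_nonneg hk (hu0 x)
  have hD0 : 0 ≤ D := by rw [hD]; positivity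
  -- Convexity of the primitive: the discarded term is `β'(u) |∇u|² ≥ 0`.
  have hQ : truncRpow k a (u x) * Δ u x ≤ Δ (fun y => truncRpowPrimitive k a (u y)) x := by
    rw [laplacian_comp (contDiff_truncRpowPrimitive hk) hu, deriv_truncRpowPrimitive hk]
    exact le_add_of_nonneg_right (mul_nonneg (truncRpow_monotone hk ha0).deriv_nonneg
      (Finset.sum_nonneg fun i _ => sq_nonneg _))
  have hy := mul_rpow_le_young (hg0 x) (hu0 x) hs (p := p)
  rw [← ha] at hy
  have hHβ := truncRpowPrimitive_le hk ha0 (hu0 x)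
  have habs := fun ht => absorb_cutoff_error (D := s * C) (by positivity) hε hk
    (ht : k ≤ u x) (hψ0 x) hn
  rw [← hD, show a + 1 + (p - 1) = p * s by rw [hps]; ring] at habs
  have hΔx := hΔ x
  have hsubx := hsub x
  have hgs : 0 ≤ g x ^ s := Real.rpow_nonneg (hg0 x) _
  have hts : u x ^ (p * s) = u x ^ a * u x ^ p := by
    rw [hps, Real.rpow_add_of_nonneg (hu0 x) ha0 hp]
  have hta : u x ^ (a + 1) = u x ^ a * u x := by
    rw [Real.rpow_add_of_nonneg (hu0 x) ha0 zero_le_one, Real.rpow_one]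
  unfold truncRpow at hQ hβ0 hHβ
  have hθ0 := Real.smoothTransition.nonneg (u x / k - 1)
  have hθ1 := Real.smoothTransition.le_one (u x / k - 1)
  have hθk := smoothTransition_div_sub_one_eq_zero hk (t := u x)
  generalize Real.smoothTransition (u x / k - 1) = θ at *
  generalize Δ (fun y => truncRpowPrimitive k a (u y)) x = Q at *
  generalize truncRpowPrimitive k a (u x) = H at *
  generalize Δ (fun y => ψ y ^ (2 * n + 2)) x = L at *
  have hψn : 0 ≤ ψ x ^ (2 * n) := pow_nonneg (hψ0 x) _
  have herr : s * (H * L) ≤ ε * (θ * u x ^ (p * s)) * ψ x ^ (2 * n + 2) + D := by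
    have h1 : s * (H * L) ≤ θ * (s * C * u x ^ (a + 1) * ψ x ^ (2 * n)) := by
      calc s * (H * L) ≤ s * (H * (C * ψ x ^ (2 * n))) := by gcongr
        _ ≤ s * (θ * u x ^ a * u x * (C * ψ x ^ (2 * n))) := by gcongr
        _ = _ := by rw [hta]; ring
    -- Where `u x ≤ k` the factor `θ` vanishes; elsewhere the absorption lemma applies, with `b = p
    -- - 1`.
    rcases le_total (u x) k with h | h
    · rw [hθk h] at h1 ⊢
      simpa using (h1.trans_eq (zero_mul _)).trans hD0
    · calc s * (H * L) ≤ θ * (ε * u x ^ (p * s) * ψ x ^ (2 * n + 2) + D) :=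
            h1.trans (mul_le_mul_of_nonneg_left (habs h) hθ0)
        _ ≤ θ * (ε * u x ^ (p * s) * ψ x ^ (2 * n + 2)) + D := by
            rw [mul_add]
            gcongr
            exact mul_le_of_le_one_left hD0 hθ1
        _ = _ := by ring
  -- Young's term `(s - 1) θ u ^ (p s)` is subtracted from `s θ u ^ (p s)`, leaving coefficient one.
  have hmain : θ * u x ^ (p * s) ≤ g x ^ s + s * Q := by
    have h1 : θ * u x ^ a * u x ^ p ≤ θ * u x ^ a * g x + Q := by
      calc θ * u x ^ a * u x ^ p ≤ θ * u x ^ a * (g x + Δ u x) := by gcongr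
        _ ≤ _ := by rw [mul_add]; gcongr
    have h2 : θ * (s * (u x ^ a * g x)) ≤ θ * (g x ^ s + (s - 1) * u x ^ (p * s)) := by gcongr
    have h3 : θ * g x ^ s ≤ g x ^ s := mul_le_of_le_one_left hgs hθ1
    have h4 := mul_le_mul_of_nonneg_left h1 hs0.le
    rw [mul_assoc θ, ← hts] at h4
    linarith
  have := mul_le_mul_of_nonneg_right hmain hφ0
  linarith

variable [MeasurableSpace E] [BorelSpace E]

theorem exists_cutoff_lintegral_le {u g : E → ℝ} {p s : ℝ} (hu : ContDiff ℝ 2 u)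
    (hu0 : ∀ x, 0 ≤ u x) (hg : Continuous g) (hg0 : ∀ x, 0 ≤ g x) (hp : 1 < p) (hs : 1 ≤ s)
    (hsub : ∀ x, u x ^ p ≤ g x + Δ u x) {k ε δ : ℝ} (hk : 0 < k) (hε : 0 < ε) (hε1 : ε ≤ 1)
    (hδ : 0 < δ) (r : ℝ) :
    ∃ φ : E → ℝ, Continuous φ ∧ (∀ x ∈ Metric.closedBall 0 r, φ x = 1) ∧
      ∫⁻ x, ENNReal.ofReal
        ((1 - ε) * (Real.smoothTransition (u x / k - 1) * u x ^ (p * s)) * φ x) ≤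
      (∫⁻ x, ENNReal.ofReal (g x ^ s)) + ENNReal.ofReal δ := by
  have hs0 : 0 < s := by linarith
  have hps : 0 ≤ p * s := by nlinarith
  set d := Module.finrank ℝ E
  set a := p * (s - 1) with ha
  have ha0 : 0 ≤ a := mul_nonneg (by linarith) (by linarith)
  have hp1 : 0 < p - 1 := by linarith
  -- `n ≥ d` makes the error decay faster than the volume of the ball grows; the other bound is the
  -- exponent condition for absorption.
  obtain ⟨n, hn⟩ := exists_nat_ge (max (d : ℝ) ((a + 1) / (p - 1)))
  have hdn : d ≤ n := by exact_mod_cast (le_max_left _ _).trans hn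
  have han : a + 1 ≤ (p - 1) * n := by
    have := (le_max_right _ _).trans hn
    rwa [div_le_iff₀' hp1] at this
  have hn0 : n ≠ 0 := by
    rintro rfl
    simp only [Nat.cast_zero, mul_zero] at han
    linarith
  obtain ⟨C, hC, hcut⟩ := exists_cutoff (E := E) n
  set V := volume.real (Metric.ball (0 : E) 1)
  set M := s * C * (s * C / ε) ^ n * k ^ (a + 1 - (p - 1) * n) with hM
  have hM0 : 0 ≤ M := by positivity
  -- The three bounds give `φ = 1` on the ball of radius `r`, monotonicity of powers of `R`, and
  -- total error at most `δ`.
  obtain ⟨R, hR⟩ : ∃ R, max (max r 1) (M * 2 ^ d * V / δ) ≤ R := ⟨_, le_rfl⟩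
  have hRr : r ≤ R := (le_max_left r 1).trans ((le_max_left _ _).trans hR)
  have hR1 : 1 ≤ R := (le_max_right r 1).trans ((le_max_left _ _).trans hR)
  have hRδ : M * 2 ^ d * V / δ ≤ R := (le_max_right _ _).trans hR
  have hR0 : 0 < R := by linarith
  obtain ⟨ψ, hψs, hψ0, hψ1, hψR, hψ2R, hψΔ⟩ := hcut R hR0
  set B := Metric.closedBall (0 : E) (2 * R)
  set D := M / R ^ (2 * n + 2) with hD
  have hD0 : 0 ≤ D := by positivity
  have hDB : D * volume.real B ≤ δ := by
    have hvol : volume.real B = (2 * R) ^ d * V :=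
      Measure.addHaar_real_closedBall _ _ (by positivity)
    have hpow : R ^ d * R ≤ R ^ (2 * n + 2) := by
      rw [← pow_succ]
      exact pow_le_pow_right₀ hR1 (by omega)
    rw [div_le_iff₀ hδ] at hRδ
    rw [hvol, hD, div_mul_eq_mul_div, div_le_iff₀ (by positivity)]
    calc M * ((2 * R) ^ d * V) = M * 2 ^ d * V * R ^ d := by rw [mul_pow]; ring
      _ ≤ R * δ * R ^ d := by gcongr
      _ = δ * (R ^ d * R) := by ring
      _ ≤ δ * R ^ (2 * n + 2) := by gcongr
  let H : E → ℝ := fun x => truncRpowPrimitive k a (u x)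
  let φ : E → ℝ := fun x => ψ x ^ (2 * n + 2)
  have hψ2 : ContDiff ℝ 2 ψ := by exact_mod_cast contDiff_infty.1 hψs 2
  have hH : ContDiff ℝ 2 H := (contDiff_truncRpowPrimitive hk).comp hu
  have hφ : ContDiff ℝ 2 φ := hψ2.pow _
  have hφ0 : ∀ x, 0 ≤ φ x := fun x => pow_nonneg (hψ0 x) _
  have hφ1 : ∀ x, φ x ≤ 1 := fun x => pow_le_one₀ (hψ0 x) (hψ1 x)
  have hφc : HasCompactSupport φ := HasCompactSupport.intro (isCompact_closedBall 0 (2 * R))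
    fun x hx => by simp [φ, hψ2R x hx]
  let X : E → ℝ := fun x => (1 - ε) * (Real.smoothTransition (u x / k - 1) * u x ^ (p * s)) * φ x
  have hXc : Continuous X := by
    have hc : Continuous fun x => u x / k - 1 := (hu.continuous.div_const k).sub continuous_const
    exact (continuous_const.mul ((Real.smoothTransition.continuous.comp hc).mul
      (hu.continuous.rpow_const fun _ => Or.inr hps))).mul hφ.continuous
  have hX0 : ∀ x, 0 ≤ X x := fun x => mul_nonneg (mul_nonneg (by linarith)
    (mul_nonneg (Real.smoothTransition.nonneg _) (Real.rpow_nonneg (hu0 x) _))) (hφ0 x)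
  have hgc : Continuous fun x => g x ^ s * φ x :=
    (hg.rpow_const fun _ => Or.inr hs0.le).mul hφ.continuous
  -- The constant error carries no cutoff, so it must be confined to `B`. Off `B`, `φ = 0`, and the
  -- cutoff bound gives `Δ φ ≤ 0` because `n ≠ 0`.
  have hpt : ∀ x, X x ≤ g x ^ s * φ x + B.indicator (fun _ => D) x +
      s * (Δ H x * φ x - H x * Δ φ x) := by
    intro x
    by_cases hx : x ∈ B
    · rw [Set.indicator_of_mem hx]
      refine subsolution_pointwise_estimate hu hu0 hg0 (by linarith) hs hk hε
        (by positivity : 0 ≤ C / R ^ 2) han hψ0 hψΔ hsub ?_ x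
      have hR2 : R ^ (2 * n + 2) = R ^ 2 * (R ^ 2) ^ n := by rw [← pow_mul]; ring
      rw [← ha, hD, hM, hR2, show s * (C / R ^ 2) / ε = s * C / ε / R ^ 2 by ring,
        div_pow _ (R ^ 2)]
      generalize (R ^ 2) ^ n = y
      ring
    · have h0 := hψ2R x hx
      have hφx : φ x = 0 := by simp [φ, h0]
      have hΔx : Δ φ x ≤ 0 := by
        have := hψΔ x
        rwa [h0, zero_pow (by omega), mul_zero] at this
      have hHx : 0 ≤ H x := truncRpowPrimitive_nonneg hk (hu0 x)
      have : X x = 0 := by simp only [X, hφx, mul_zero]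
      rw [this, Set.indicator_of_notMem hx, hφx]
      have := mul_nonneg hs0.le (mul_nonneg hHx (neg_nonneg.2 hΔx))
      linarith
  have iX : Integrable X := hXc.integrable_of_hasCompactSupport hφc.mul_left
  have ig : Integrable fun x => g x ^ s * φ x :=
    hgc.integrable_of_hasCompactSupport hφc.mul_left
  have iB : Integrable (B.indicator fun _ : E => D) :=
    (integrable_indicator_iff Metric.isClosed_closedBall.measurableSet).2
      (integrableOn_const (isCompact_closedBall _ _).measure_ne_top)
  have i1 : Integrable fun x => Δ H x * φ x :=
    (hH.continuous_laplacian.mul hφ.continuous).integrable_of_hasCompactSupport hφc.mul_left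
  have i2 : Integrable fun x => H x * Δ φ x :=
    (hH.continuous.mul hφ.continuous_laplacian).integrable_of_hasCompactSupport
      hφc.laplacian.mul_left
  have i12 : Integrable fun x => Δ H x * φ x - H x * Δ φ x := i1.sub i2
  have igB : Integrable fun x => g x ^ s * φ x + B.indicator (fun _ => D) x := ig.add iB
  have hint : ∫ x, X x ≤ (∫ x, g x ^ s * φ x) + δ := by
    calc ∫ x, X x ≤ ∫ x, (g x ^ s * φ x + B.indicator (fun _ => D) x +
          s * (Δ H x * φ x - H x * Δ φ x)) :=
          integral_mono iX (igB.add (i12.const_mul s)) hpt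
      _ = (∫ x, g x ^ s * φ x) + D * volume.real B := by
          rw [integral_add igB (i12.const_mul s), integral_add ig iB,
            integral_const_mul, integral_sub i1 i2, integral_mul_laplacian_comm hH hφ hφc,
            sub_self, mul_zero, add_zero,
            integral_indicator Metric.isClosed_closedBall.measurableSet, setIntegral_const,
            smul_eq_mul, mul_comm D]
      _ ≤ _ := by gcongr
  refine ⟨φ, hφ.continuous, fun x hx => ?_, ?_⟩
  · simp only [φ, hψR x (Metric.closedBall_subset_closedBall hRr hx), one_pow]
  · rw [← ofReal_integral_eq_lintegral_ofReal iX (Filter.Eventually.of_forall hX0)]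
    calc ENNReal.ofReal (∫ x, X x) ≤ ENNReal.ofReal ((∫ x, g x ^ s * φ x) + δ) :=
          ENNReal.ofReal_le_ofReal hint
      _ ≤ ENNReal.ofReal (∫ x, g x ^ s * φ x) + ENNReal.ofReal δ := ENNReal.ofReal_add_le
      _ ≤ _ := by
          rw [ofReal_integral_eq_lintegral_ofReal ig (Filter.Eventually.of_forall fun x =>
            mul_nonneg (Real.rpow_nonneg (hg0 x) _) (hφ0 x))]
          gcongr with x
          exact mul_le_of_le_one_right (Real.rpow_nonneg (hg0 x) _) (hφ1 x)

/-- One sequence `δ j → 0` serves as truncation level, absorbed fraction and error, with radius `j`.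
The integrands converge pointwise, also where `u = 0` since `p * s > 0`, and Fatou concludes. -/
theorem lintegral_rpow_le_of_smooth_subsolution {u g : E → ℝ} {p s : ℝ} (hu : ContDiff ℝ 2 u)
    (hu0 : ∀ x, 0 ≤ u x) (hg : Continuous g) (hg0 : ∀ x, 0 ≤ g x) (hp : 1 < p) (hs : 1 ≤ s)
    (hsub : ∀ x, u x ^ p ≤ g x + Δ u x) :
    ∫⁻ x, ENNReal.ofReal (u x ^ (p * s)) ≤ ∫⁻ x, ENNReal.ofReal (g x ^ s) := by
  have hps : 0 < p * s := by nlinarith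
  let δ : ℕ → ℝ := fun j => 1 / ((j : ℝ) + 1)
  have hδ : ∀ j, 0 < δ j := fun j => by positivity
  have hδ1 : ∀ j, δ j ≤ 1 := fun j => by
    rw [div_le_one (by positivity)]
    linarith [(Nat.cast_nonneg j : (0 : ℝ) ≤ j)]
  have hlim : Filter.Tendsto δ Filter.atTop (nhds 0) := tendsto_one_div_add_atTop_nhds_zero_nat
  choose φ hφc hφ1 hφ using fun j : ℕ => exists_cutoff_lintegral_le hu hu0 hg hg0 hp hs hsub
    (hδ j) (hδ j) (hδ1 j) (hδ j) (j : ℝ)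
  have hpt : ∀ x, Filter.Tendsto (fun j => ENNReal.ofReal ((1 - δ j) *
      (Real.smoothTransition (u x / δ j - 1) * u x ^ (p * s)) * φ j x)) Filter.atTop
      (nhds (ENNReal.ofReal (u x ^ (p * s)))) := by
    intro x
    refine ENNReal.tendsto_ofReal ?_
    have h1 : ∀ᶠ j : ℕ in Filter.atTop, φ j x = 1 := by
      filter_upwards [Filter.eventually_ge_atTop ⌈‖x‖⌉₊] with j hj
      refine hφ1 j x ?_
      rw [mem_closedBall_zero_iff]
      exact Nat.ceil_le.1 hj
    have h2 : ∀ᶠ j : ℕ in Filter.atTop,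
        Real.smoothTransition (u x / δ j - 1) * u x ^ (p * s) = u x ^ (p * s) := by
      rcases (hu0 x).eq_or_lt with h | h
      · refine Filter.Eventually.of_forall fun j => ?_
        rw [← h, Real.zero_rpow hps.ne', mul_zero]
      · filter_upwards [hlim.eventually_le_const (half_pos h)] with j hj
        rw [Real.smoothTransition.one_of_one_le, one_mul]
        rw [le_sub_iff_add_le, le_div_iff₀ (hδ j)]
        linarith
    have h3 : Filter.Tendsto (fun j => (1 - δ j) * u x ^ (p * s)) Filter.atTop
        (nhds ((1 - 0) * u x ^ (p * s))) := (tendsto_const_nhds.sub hlim).mul_const _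
    rw [sub_zero, one_mul] at h3
    refine h3.congr' ?_
    filter_upwards [h1, h2] with j e1 e2
    rw [e1, e2, mul_one]
  have hmeas : ∀ j, Measurable fun x => ENNReal.ofReal ((1 - δ j) *
      (Real.smoothTransition (u x / δ j - 1) * u x ^ (p * s)) * φ j x) := by
    intro j
    have := hu.continuous.measurable
    have := (hφc j).measurable
    have hc : Continuous fun x => u x / δ j - 1 :=
      (hu.continuous.div_const (δ j)).sub continuous_const
    have : Measurable fun x => Real.smoothTransition (u x / δ j - 1) :=
      (Real.smoothTransition.continuous.comp hc).measurable
    fun_prop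
  calc ∫⁻ x, ENNReal.ofReal (u x ^ (p * s))
      = ∫⁻ x, Filter.liminf (fun j => ENNReal.ofReal ((1 - δ j) *
          (Real.smoothTransition (u x / δ j - 1) * u x ^ (p * s)) * φ j x)) Filter.atTop :=
        lintegral_congr fun x => (hpt x).liminf_eq.symm
    _ ≤ Filter.liminf (fun j => ∫⁻ x, ENNReal.ofReal ((1 - δ j) *
          (Real.smoothTransition (u x / δ j - 1) * u x ^ (p * s)) * φ j x)) Filter.atTop :=
        lintegral_liminf_le hmeas
    _ ≤ Filter.liminf (fun j => (∫⁻ x, ENNReal.ofReal (g x ^ s)) + ENNReal.ofReal (δ j))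
          Filter.atTop := Filter.liminf_le_liminf (Filter.Eventually.of_forall hφ)
    _ = ∫⁻ x, ENNReal.ofReal (g x ^ s) := by
        refine Filter.Tendsto.liminf_eq ?_
        have := (tendsto_const_nhds (x := ∫⁻ x, ENNReal.ofReal (g x ^ s))).add
          (ENNReal.tendsto_ofReal hlim)
        simpa using this

end SmoothCase

/-! ### Jensen's inequality and mollification -/

section Mollification

open Laplacian Convolution

theorem rpow_tangent_le {c t p : ℝ} (hc : 0 ≤ c) (ht : 0 ≤ t) (hp : 1 ≤ p) :
    c ^ p + p * c ^ (p - 1) * (t - c) ≤ t ^ p := by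
  -- Bernoulli's inequality needs the ratio `t / c`. At `c = 0`, the case `p = 1` is apart because
  -- `0 ^ (0 : ℝ) = 1`.
  rcases hc.eq_or_lt with rfl | hc
  · rcases hp.eq_or_lt with rfl | hp
    · simp
    · rw [Real.zero_rpow (by linarith), Real.zero_rpow (by linarith)]
      simpa using Real.rpow_nonneg ht p
  · have h := one_add_mul_self_le_rpow_one_add (s := t / c - 1) (p := p)
      (by linarith [div_nonneg ht hc.le]) hp
    rw [add_sub_cancel, Real.div_rpow ht hc.le, le_div_iff₀ (Real.rpow_pos_of_pos hc p)] at h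
    have hcp : c ^ p = c ^ (p - 1) * c := by
      rw [← Real.rpow_add_one hc.ne', sub_add_cancel]
    calc c ^ p + p * c ^ (p - 1) * (t - c) = (1 + p * (t / c - 1)) * c ^ p := by
          rw [hcp]; field_simp
      _ ≤ t ^ p := h

/-- Jensen: integrate the tangent line at the mean `c` against `w`; the linear term cancels. -/
theorem rpow_integral_mul_le {α : Type*} [MeasurableSpace α] {μ : Measure α} {w v : α → ℝ}
    {p : ℝ} (hp : 1 ≤ p) (hw0 : ∀ y, 0 ≤ w y) (hw : ∫ y, w y ∂μ = 1) (hv0 : ∀ᵐ y ∂μ, 0 ≤ v y)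
    (hwv : Integrable (fun y => w y * v y) μ) (hwvp : Integrable (fun y => w y * v y ^ p) μ) :
    (∫ y, w y * v y ∂μ) ^ p ≤ ∫ y, w y * v y ^ p ∂μ := by
  have iw : Integrable w μ := by
    by_contra h
    rw [integral_undef h] at hw
    exact zero_ne_one hw
  set c := ∫ y, w y * v y ∂μ with hc
  have hc0 : 0 ≤ c := integral_nonneg_of_ae (hv0.mono fun y hy => mul_nonneg (hw0 y) hy)
  have i1 : Integrable (fun y => (c ^ p - p * c ^ (p - 1) * c) * w y) μ := iw.const_mul _
  have i2 : Integrable (fun y => p * c ^ (p - 1) * (w y * v y)) μ := hwv.const_mul _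
  calc c ^ p = ∫ y, ((c ^ p - p * c ^ (p - 1) * c) * w y + p * c ^ (p - 1) * (w y * v y)) ∂μ := by
        rw [integral_add i1 i2, integral_const_mul, integral_const_mul, hw, ← hc]
        ring
    _ ≤ ∫ y, w y * v y ^ p ∂μ := by
        refine integral_mono_ae (i1.add i2) hwvp (hv0.mono fun y hy => ?_)
        have := mul_le_mul_of_nonneg_left (rpow_tangent_le hc0 hy hp) (hw0 y)
        simp only
        linarith

variable {E : Type*} [NormedAddCommGroup E] [InnerProductSpace ℝ E] [FiniteDimensional ℝ E]
  [MeasurableSpace E] [BorelSpace E]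

/-- The mollification of `v` by the normalized bump function `b`. -/
noncomputable def mollify (b : ContDiffBump (0 : E)) (v : E → ℝ) : E → ℝ :=
  b.normed volume ⋆[ContinuousLinearMap.lsmul ℝ ℝ, volume] v

variable (b : ContDiffBump (0 : E)) {v f : E → ℝ}

theorem mollify_apply (v : E → ℝ) (x : E) :
    mollify b v x = ∫ y, b.normed volume (x - y) * v y := by
  rw [mollify, convolution_eq_swap]
  rfl

theorem integrable_normed_sub_mul (hv : LocallyIntegrable v volume) (x : E) :
    Integrable fun y => b.normed volume (x - y) * v y :=
  (b.hasCompactSupport_normed.convolutionExists_left (ContinuousLinearMap.lsmul ℝ ℝ)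
    b.continuous_normed hv x).integrable_swap

theorem contDiff_mollify (hv : LocallyIntegrable v volume) {n : ℕ∞} : ContDiff ℝ n (mollify b v) :=
  b.hasCompactSupport_normed.contDiff_convolution_left _ b.contDiff_normed hv

theorem mollify_nonneg (hv0 : ∀ᵐ x, 0 ≤ v x) (x : E) : 0 ≤ mollify b v x := by
  rw [mollify_apply]
  exact integral_nonneg_of_ae (hv0.mono fun y hy => mul_nonneg (b.nonneg_normed _) hy)

theorem mollify_rpow_le {p : ℝ} (hp : 1 ≤ p) (hv0 : ∀ᵐ x, 0 ≤ v x)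
    (hv : LocallyIntegrable v volume) (hvp : LocallyIntegrable (fun x => v x ^ p) volume) (x : E) :
    mollify b v x ^ p ≤ mollify b (fun x => v x ^ p) x := by
  rw [mollify_apply, mollify_apply]
  refine rpow_integral_mul_le hp (fun y => b.nonneg_normed _) ?_ hv0
    (integrable_normed_sub_mul b hv x) (integrable_normed_sub_mul b hvp x)
  rw [integral_sub_left_eq_self (b.normed volume) volume x, b.integral_normed]

/-- Tonelli, translation invariance and unit mass of the mollifier. -/
theorem lintegral_mollify (hf0 : ∀ᵐ x, 0 ≤ f x) (hf : Integrable f) :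
    ∫⁻ x, ENNReal.ofReal (mollify b f x) = ∫⁻ x, ENNReal.ofReal (f x) := by
  have hb : Measurable fun x => ENNReal.ofReal (b.normed volume x) :=
    b.continuous_normed.measurable.ennreal_ofReal
  have hb1 : ∫⁻ x, ENNReal.ofReal (b.normed volume x) = 1 := by
    rw [← ofReal_integral_eq_lintegral_ofReal b.integrable_normed
      (Filter.Eventually.of_forall fun x => b.nonneg_normed x), b.integral_normed,
      ENNReal.ofReal_one]
  calc ∫⁻ x, ENNReal.ofReal (mollify b f x)
      = ∫⁻ x, ∫⁻ y, ENNReal.ofReal (b.normed volume (x - y)) * ENNReal.ofReal (f y) := by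
        refine lintegral_congr fun x => ?_
        rw [mollify_apply, ofReal_integral_eq_lintegral_ofReal
          (integrable_normed_sub_mul b hf.locallyIntegrable x)
          (hf0.mono fun y hy => mul_nonneg (b.nonneg_normed _) hy)]
        exact lintegral_congr fun y => ENNReal.ofReal_mul (b.nonneg_normed _)
    _ = ∫⁻ y, ∫⁻ x, ENNReal.ofReal (b.normed volume (x - y)) * ENNReal.ofReal (f y) := by
        refine lintegral_lintegral_swap ?_
        exact (hb.comp (measurable_fst.sub measurable_snd)).aemeasurable.mul
          hf.aestronglyMeasurable.aemeasurable.ennreal_ofReal.comp_snd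
    _ = ∫⁻ y, ENNReal.ofReal (f y) := by
        refine lintegral_congr fun y => ?_
        have hby : Measurable fun x => ENNReal.ofReal (b.normed volume (x - y)) :=
          hb.comp (measurable_id.sub_const y)
        rw [lintegral_mul_const _ hby,
          lintegral_sub_right_eq_self (fun x => ENNReal.ofReal (b.normed volume x)), hb1, one_mul]

theorem lintegral_mollify_rpow_le {s : ℝ} (hs : 1 ≤ s) (hf0 : ∀ᵐ x, 0 ≤ f x)
    (hf : LocallyIntegrable f volume) (hfs : Integrable fun x => f x ^ s) :
    ∫⁻ x, ENNReal.ofReal (mollify b f x ^ s) ≤ ∫⁻ x, ENNReal.ofReal (f x ^ s) :=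
  (lintegral_mono fun x => ENNReal.ofReal_le_ofReal
    (mollify_rpow_le b hs hf0 hf hfs.locallyIntegrable x)).trans
    (lintegral_mollify b (hf0.mono fun _ hx => Real.rpow_nonneg hx s) hfs).le

theorem IsDistribSubsolution.mollify_rpow_le {N : ℕ} {q : ℝ}
    {f v : EuclideanSpace ℝ (Fin N) → ℝ} (hv : IsDistribSubsolution q f v) (hq : 2 ≤ q)
    (hv0 : ∀ᵐ x, 0 ≤ v x) (b : ContDiffBump (0 : EuclideanSpace ℝ (Fin N)))
    (x : EuclideanSpace ℝ (Fin N)) :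
    mollify b v x ^ (q - 1) ≤ mollify b f x + Δ (mollify b v) x := by
  set ρ := b.normed volume
  have hρ : ContDiff ℝ ∞ ρ := b.contDiff_normed (n := (⊤ : ℕ∞))
  have hρ2 : ContDiff ℝ 2 ρ := b.contDiff_normed (n := 2)
  have hφ : ∀ y, x + (-1 : ℝ) • y = x - y := fun y => by rw [neg_one_smul, sub_eq_add_neg]
  have hΔ : ∀ y, Δ (fun z => ρ (x - z)) y = Δ ρ (x - y) := by
    intro y
    have := laplacian_comp_affine hρ2 x (-1) y
    simpa only [hφ, neg_one_sq, one_mul] using this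
  -- The test function is the mollifier reflected and centred at `x`, so each integral becomes a
  -- convolution evaluated at `x`.
  have htest := hv.le_of_test (fun y => ρ (x - y)) (hρ.comp (contDiff_const.sub contDiff_id))
    (b.hasCompactSupport_normed.comp_homeomorph (Homeomorph.subLeft x))
    (fun y => b.nonneg_normed _)
  simp only [hΔ] at htest
  have hΔv : Δ (mollify b v) x = ∫ y, v y * Δ ρ (x - y) := by
    rw [mollify, laplacian_convolution hρ2 b.hasCompactSupport_normed hv.locallyIntegrable]
    simp only [mul_comm, ρ]
  have h := _root_.mollify_rpow_le b (by linarith : 1 ≤ q - 1) hv0 hv.locallyIntegrable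
    hv.locallyIntegrable_rpow x
  rw [mollify_apply b (fun x => v x ^ (q - 1))] at h
  rw [hΔv, mollify_apply b f]
  simp only [mul_comm (v _ ^ (q - 1)), mul_comm (f _)] at htest
  linarith

end Mollification

/-! ### Passage to the limit and the theorem -/

section Contraction

open Filter

theorem IsDistribSubsolution.lintegral_rpow_le {N : ℕ} {q s : ℝ}
    {f v : EuclideanSpace ℝ (Fin N) → ℝ} (hv : IsDistribSubsolution q f v) (hq : 2 < q)
    (hs : 1 ≤ s) (hf0 : ∀ᵐ x, 0 ≤ f x) (hv0 : ∀ᵐ x, 0 ≤ v x)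
    (hfs : Integrable fun x => f x ^ s) :
    ∫⁻ x, ENNReal.ofReal (v x ^ ((q - 1) * s)) ≤ ∫⁻ x, ENNReal.ofReal (f x ^ s) := by
  have hqs : 0 < (q - 1) * s := by nlinarith
  -- The outer radius tends to zero while the ratio of radii stays `2`, as Lebesgue differentiation
  -- requires.
  let b : ℕ → ContDiffBump (0 : EuclideanSpace ℝ (Fin N)) := fun j =>
    ⟨1 / ((j : ℝ) + 1) / 2, 1 / ((j : ℝ) + 1), by positivity, half_lt_self (by positivity)⟩
  have hlim : ∀ᵐ x, Tendsto (fun j => mollify (b j) v x) atTop (nhds (v x)) :=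
    ContDiffBump.ae_convolution_tendsto_right_of_locallyIntegrable (K := 2)
      tendsto_one_div_add_atTop_nhds_zero_nat
      (Eventually.of_forall fun j => by simp only [b]; linarith) hv.locallyIntegrable
  have hcont : ∀ j, ContDiff ℝ 2 (mollify (b j) v) :=
    fun j => contDiff_mollify (b j) hv.locallyIntegrable (n := 2)
  calc ∫⁻ x, ENNReal.ofReal (v x ^ ((q - 1) * s))
      = ∫⁻ x, liminf (fun j => ENNReal.ofReal (mollify (b j) v x ^ ((q - 1) * s))) atTop := by
        refine lintegral_congr_ae (hlim.mono fun x hx => ?_)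
        exact (ENNReal.tendsto_ofReal (hx.rpow_const (Or.inr hqs.le))).liminf_eq.symm
    _ ≤ liminf (fun j => ∫⁻ x, ENNReal.ofReal (mollify (b j) v x ^ ((q - 1) * s))) atTop :=
        lintegral_liminf_le fun j =>
          ((hcont j).continuous.rpow_const fun _ => Or.inr hqs.le).measurable.ennreal_ofReal
    _ ≤ liminf (fun _ : ℕ => ∫⁻ x, ENNReal.ofReal (f x ^ s)) atTop := by
        refine liminf_le_liminf (Eventually.of_forall fun j => ?_)
        exact (lintegral_rpow_le_of_smooth_subsolution (hcont j) (mollify_nonneg (b j) hv0)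
          (contDiff_mollify (b j) hv.locallyIntegrable_rhs (n := 0)).continuous
          (mollify_nonneg (b j) hf0) (by linarith) hs (hv.mollify_rpow_le hq.le hv0 (b j))).trans
          (lintegral_mollify_rpow_le (b j) hs hf0 hv.locallyIntegrable_rhs hfs)
    _ = _ := liminf_const _

theorem eLpNorm_ofReal_rpow_of_nonneg {α : Type*} [MeasurableSpace α] {μ : Measure α}
    {g : α → ℝ} {r : ℝ} (hr : 0 < r) (hg : ∀ᵐ x ∂μ, 0 ≤ g x) :
    eLpNorm g (ENNReal.ofReal r) μ = (∫⁻ x, ENNReal.ofReal (g x ^ r) ∂μ) ^ (1 / r) := by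
  rw [eLpNorm_eq_lintegral_rpow_enorm_toReal (by simpa using hr) ENNReal.ofReal_ne_top,
    ENNReal.toReal_ofReal hr.le]
  congr 1
  refine lintegral_congr_ae (hg.mono fun x hx => ?_)
  simp only
  rw [Real.enorm_of_nonneg hx, ENNReal.ofReal_rpow_of_nonneg hx hr.le]

theorem theoremA1 {N : ℕ} (hN : 2 ≤ N) {q : ℝ} (hq : 2 < q) {s : ℝ} (hs : 1 ≤ s)
    (f v : EuclideanSpace ℝ (Fin N) → ℝ)
    (hf_nonneg : ∀ᵐ x, 0 ≤ f x) (hf : MemLp f (ENNReal.ofReal s) volume)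
    (hv_nonneg : ∀ᵐ x, 0 ≤ v x) (hv : IsDistribSubsolution q f v) :
    MemLp (fun x => v x ^ (q - 1)) (ENNReal.ofReal s) volume ∧
      eLpNorm v (ENNReal.ofReal ((q - 1) * s)) volume ^ (q - 1) ≤
        eLpNorm f (ENNReal.ofReal s) volume := by
  have hs0 : 0 < s := by linarith
  have hq0 : 0 < q - 1 := by linarith
  have hfs : Integrable fun x => f x ^ s := by
    refine (hf.integrable_norm_rpow (by simpa using hs0) ENNReal.ofReal_ne_top).congr
      (hf_nonneg.mono fun x hx => ?_)
    simp only [Real.norm_of_nonneg hx, ENNReal.toReal_ofReal hs0.le]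
  have key := hv.lintegral_rpow_le hq hs hf_nonneg hv_nonneg hfs
  have hle : eLpNorm v (ENNReal.ofReal ((q - 1) * s)) volume ^ (q - 1) ≤
      eLpNorm f (ENNReal.ofReal s) volume := by
    rw [eLpNorm_ofReal_rpow_of_nonneg (mul_pos hq0 hs0) hv_nonneg,
      eLpNorm_ofReal_rpow_of_nonneg hs0 hf_nonneg, ← ENNReal.rpow_mul,
      show 1 / ((q - 1) * s) * (q - 1) = 1 / s by field_simp]
    exact ENNReal.rpow_le_rpow key (by positivity)
  have heq : eLpNorm (fun x => v x ^ (q - 1)) (ENNReal.ofReal s) volume =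
      (∫⁻ x, ENNReal.ofReal (v x ^ ((q - 1) * s))) ^ (1 / s) := by
    rw [eLpNorm_ofReal_rpow_of_nonneg hs0 (hv_nonneg.mono fun x hx => Real.rpow_nonneg hx _)]
    congr 1
    refine lintegral_congr_ae (hv_nonneg.mono fun x hx => ?_)
    simp only [Real.rpow_mul hx]
  refine ⟨⟨hv.locallyIntegrable_rpow.aestronglyMeasurable, ?_⟩, hle⟩
  rw [heq]
  refine lt_of_le_of_lt (ENNReal.rpow_le_rpow key (by positivity)) ?_
  rw [← eLpNorm_ofReal_rpow_of_nonneg hs0 hf_nonneg]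
  exact hf.2

end Contraction
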